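/- There is a complete first-order theory $T$ which is strongly$^1$ stable but not strongly$^2$ stable. Moreover, for every field $\mathbb F$ such a $T$ can be found of the form $T=\mathrm{Th}(V;0,+,-,(c\,\cdot)_{c\in\mathbb F},(P_n)_{n<\omega})$, where $V$ is an $\mathbb F$-vector space, $V=P_0\supseteq P_1\supseteq P_2\supseteq\cdots$ is a decreasing chain of subspaces (named by unary predicates), every quotient $P_n/P_{n+1}$ is infinite dimensional and $\bigcap_{n<\omega}P_n$ is infinite dimensional. Here $T$ is stable if no formula $\varphi(\bar x,\bar y)$ has the order property in a model of $T$; and for $\ell=1,2$, $T$ is strongly$^\ell$ stable if it is stable and strongly$^\ell$ dependent, i.e. $\kappa_{\mathrm{ict},\ell}(T)=\aleph_0$, where: $\bullet$ $\kappa_{\mathrm{ict},1}(T)=\kappa_{\mathrm{ict}}(T)$ is the least cardinal $\kappa$ such that for no sequence of formulas $\langle\varphi_i(\bar x,\bar y_i):i<\kappa\rangle$, with $\bar x$ a finite tuple, is the set $\{\varphi_i(\bar x_\eta,\bar y^i_\alpha)^{\mathrm{if}(\eta(i)=\alpha)}:\eta\in{}^{\kappa}\lambda,\ \alpha<\lambda,\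 i<\kappa\}$ consistent with $T$ for some (equivalently, every) infinite $\lambda$; here $\varphi^{\mathrm{if}(\theta)}$ is $\varphi$ if $\theta$ holds and $\neg\varphi$ otherwise. $\bullet$ $\kappa_{\mathrm{ict},2}(T)$ is the least cardinal $\kappa$ for which there are no formulas $\langle\varphi_i(\bar x,\bar y_i):i<\kappa\rangle$, with $\bar x$ a finite tuple, and finite tuples $\bar a_{i,\alpha}$ ($i<\kappa$, $\alpha<\omega$) and $\bar b_i$ ($i<\kappa$) in a model of $T$ such that (a) for each $i$, $\langle\bar a_{i,\alpha}:\alpha<\omega\rangle$ is an indiscernible sequence over $\bigcup\{\bar a_{j,\beta}:j\ne i,\ \beta<\omega\}$; (b) $\bar b_i\subseteq\bigcup\{\bar a_{j,\alpha}:j<i,\ \alpha<\omega\}$; (c) $\{\varphi_i(\bar x,\bar a_{i,0}{}^\frown\bar b_i),\ \neg\varphi_i(\bar x,\bar a_{i,1}{}^\frown\bar b_i):i<\kappa\}$ is finitely satisfiable. -/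

import Mathlib

universe u v w

namespace ShelahStrong

open FirstOrder FirstOrder.Language Cardinal

/-! ### Model-theoretic notions -/

section Notions

variable {L : FirstOrder.Language.{u, v}}

/-- A sequence `⟨a_t : t ∈ J⟩` of `k`-tuples of `M` is an indiscernible sequence over `A ⊆ M`: any
two increasing finite subsequences of the same length satisfy the same formulas with parameters
from `A`. -/
def IndiscernibleOver {M : Type w} [L.Structure M] (A : Set M) {J : Type*} [LinearOrder J]
    {k : ℕ} (a : J → Fin k → M) : Prop :=
  ∀ (n : ℕ) (ψ : L.Formula (A ⊕ (Fin n × Fin k))) (s t : Fin n ↪o J),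
    ψ.Realize (Sum.elim (fun c : A => (c : M)) fun p => a (s p.1) p.2) ↔
      ψ.Realize (Sum.elim (fun c : A => (c : M)) fun p => a (t p.1) p.2)

/-- `T` is stable: no formula `φ(x̄, ȳ)` has the order property in a model of `T`. -/
def IsStable (T : L.Theory) : Prop :=
  ¬ ∃ (M : Theory.ModelType.{u, v, max u v} T) (m n : ℕ) (φ : L.Formula (Fin m ⊕ Fin n))
      (a : ℕ → Fin m → M) (b : ℕ → Fin n → M),
    ∀ i j : ℕ, φ.Realize (Sum.elim (a i) (b j)) ↔ i < j

/-- The formulas `⟨φ_i(x̄, ȳ_i) : i ∈ I⟩` witness `|I| < κ_ict(T)`: for some infinite `λ`, the set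
`{φ_i(x̄_η, ȳ^i_α)^{if (η(i) = α)} : η ∈ ^I λ, α < λ, i ∈ I}` is consistent with `T`, i.e. it is
satisfied by some tuples `x̄_η` and `ȳ^i_α` in some model of `T`. -/
def WitnessIct (T : L.Theory) {I : Type (max u v)} {m : ℕ} {n : I → ℕ}
    (φ : ∀ i, L.Formula (Fin m ⊕ Fin (n i))) : Prop :=
  ∃ Λ : Type (max u v), Infinite Λ ∧
    ∃ (M : Theory.ModelType.{u, v, max u v} T) (x : (I → Λ) → Fin m → M)
      (y : ∀ i, Λ → Fin (n i) → M),
      ∀ (η : I → Λ) (i : I) (α : Λ),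
        (φ i).Realize (Sum.elim (x η) (y i α)) ↔ η i = α

/-- `κ_ict(T)`: the least cardinal `κ` such that no sequence of `κ` formulas `φ_i(x̄, ȳ_i)`,
with `x̄` of any finite length, is a witness. -/
noncomputable def kappaIct (T : L.Theory) : Cardinal.{max u v} :=
  sInf {κ | ¬ ∃ (m : ℕ) (n : κ.ord.ToType → ℕ) (φ : ∀ i, L.Formula (Fin m ⊕ Fin (n i))),
    WitnessIct T φ}

/-- The formulas `⟨φ_i(x̄, ȳ_i) : i ∈ I⟩`, where `I` is well ordered and `ȳ_i` is split as a tuple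
of length `n i` followed by a tuple of length `k i`, witness `|I| < κ_{ict,2}(T)`: in some model
of `T` there are `ā_{i,α}` and `b̄_i` such that

* `⟨ā_{i,α} : α < ω⟩` is indiscernible over `⋃ {ā_{j,β} : j ≠ i, β < ω}`, for each `i`;
* `b̄_i ⊆ ⋃ {ā_{j,α} : j < i, α < ω}`;
* `{φ_i(x̄, ā_{i,0} ⌢ b̄_i), ¬ φ_i(x̄, ā_{i,1} ⌢ b̄_i) : i ∈ I}` is finitely satisfiable. -/
def WitnessIct2 (T : L.Theory) {I : Type (max u v)} [LinearOrder I] {m : ℕ} {n k : I → ℕ}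
    (φ : ∀ i, L.Formula (Fin m ⊕ (Fin (n i) ⊕ Fin (k i)))) : Prop :=
  ∃ (M : Theory.ModelType.{u, v, max u v} T) (a : ∀ i, ℕ → Fin (n i) → M)
    (b : ∀ i, Fin (k i) → M),
    (∀ i, IndiscernibleOver (L := L) {c : M | ∃ j, j ≠ i ∧ ∃ β, c ∈ Set.range (a j β)} (a i)) ∧
    (∀ i l, ∃ j, j < i ∧ ∃ α, b i l ∈ Set.range (a j α)) ∧
    ∀ s : Finset I, ∃ x : Fin m → M, ∀ i ∈ s,
      (φ i).Realize (Sum.elim x (Sum.elim (a i 0) (b i))) ∧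
        ¬ (φ i).Realize (Sum.elim x (Sum.elim (a i 1) (b i)))

/-- `κ_{ict,2}(T)`: the least cardinal `κ` such that no sequence of `κ` formulas is a witness for
`κ < κ_{ict,2}(T)`. -/
noncomputable def kappaIct2 (T : L.Theory) : Cardinal.{max u v} :=
  sInf {κ | ¬ ∃ (m : ℕ) (n k : κ.ord.ToType → ℕ)
    (φ : ∀ i, L.Formula (Fin m ⊕ (Fin (n i) ⊕ Fin (k i)))), WitnessIct2 T φ}

/-- `T` is strongly¹ dependent. -/
def StronglyDependent1 (T : L.Theory) : Prop := kappaIct T = ℵ₀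

/-- `T` is strongly² dependent. -/
def StronglyDependent2 (T : L.Theory) : Prop := kappaIct2 T = ℵ₀

/-- `T` is strongly¹ stable. -/
def StronglyStable1 (T : L.Theory) : Prop := StronglyDependent1 T ∧ IsStable T

/-- `T` is strongly² stable. -/
def StronglyStable2 (T : L.Theory) : Prop := StronglyDependent2 T ∧ IsStable T

end Notions

/-! ### Vector spaces with a sequence of subspaces as first-order structures -/

section Chain

/-- Function symbols of `F`-vector spaces: `0`, `c x` (for `c ∈ F`), `x + y`, `x - y`. -/
inductive ChainFunc (F : Type u) : ℕ → Type u
  | zero : ChainFunc F 0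
  | smul (c : F) : ChainFunc F 1
  | add : ChainFunc F 2
  | sub : ChainFunc F 2

/-- Unary predicates `P_n`, for `n ∈ ℕ`. -/
inductive ChainRel : ℕ → Type
  | P (n : ℕ) : ChainRel 1

/-- The language of `F`-vector spaces with unary predicates `P_n`. -/
def chainLanguage (F : Type u) : FirstOrder.Language.{u, 0} := ⟨ChainFunc F, ChainRel⟩

variable {F : Type u} [Field F] {V : Type v} [AddCommGroup V] [Module F V]

/-- An `F`-vector space `V` with subspaces `P n`, as a first-order structure. -/
@[reducible] def chainStructure (P : ℕ → Submodule F V) : (chainLanguage F).Structure V where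
  funMap {_} f x :=
    match f with
    | .zero => 0
    | .smul c => c • x 0
    | .add => x 0 + x 1
    | .sub => x 0 - x 1
  RelMap {_} r x :=
    match r with
    | .P n => x 0 ∈ P n

/-- The complete first-order theory of `(V; 0, +, -, (c ·)_{c ∈ F}, (P_n)_{n ∈ ℕ})`. -/
def chainTheory (P : ℕ → Submodule F V) : (chainLanguage F).Theory :=
  letI := chainStructure P
  (chainLanguage F).completeTheory V

end Chain

end ShelahStrong

/-! Take `V` with basis indexed by `ℕ∞ × ℕ`, and let `P n` be spanned by the basis vectors of level
at least `n`. The vectors of level `⊤` span the intersection. Quantifier elimination carries the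
positive half. A formula depends only on finitely many conditions that a linear form lies in some `P
n` or vanishes (`Determined.all`, `determined_formula`). In one variable such conditions describe
cosets of subspaces in a chain, and thickness supplies a point in a given coset outside finitely
many cosets of deeper levels. Thickness is first order, so every model is again a thick chain
(`exists_eq_chainStructure`). Stability follows because iterated ultrafilter limits of these
conditions commute (`Determined.not_orderProperty`). Strong¹ dependence follows because `m + 1`
linear forms in `m` variables are dependent. In a relation between them, the form with the largest
subspace is controlled by the others, so `m + 1` rows cannot vary independently
(`not_independentPattern`). Strong² dependence fails because row `i` may use parameters from earlier
rows (`exists_witnessIct2`). Once the components of `x` below level `i` have been subtracted, `P (i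
+ 1)` tests its component at level `i`. One variable thus handles infinitely many rows. Without
these parameters, the coset of `x` modulo a deep subspace already determines its cosets modulo the
shallower ones. -/

namespace ShelahStrong

open FirstOrder FirstOrder.Language Cardinal

/-! ### Quantifier elimination for thick chains of subspaces -/

section Elimination

variable {F : Type u} [Field F] {V : Type v} [AddCommGroup V] [Module F V]

/-- The chain of subspaces `P n` together with `0` as the subspace at level `⊤`. -/
def level (P : ℕ → Submodule F V) : ℕ∞ → Submodule F V
  | ⊤ => ⊥
  | (n : ℕ) => P n

@[simp] theorem level_top (P : ℕ → Submodule F V) : level P ⊤ = ⊥ := rfl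

@[simp] theorem level_coe (P : ℕ → Submodule F V) (n : ℕ) : level P n = P n := rfl

theorem level_antitone {P : ℕ → Submodule F V} (hP : Antitone P) : Antitone (level P) := by
  intro a b hab
  induction b using ENat.recTopCoe with
  | top => simp
  | coe b =>
    induction a using ENat.recTopCoe with
    | top => simp at hab
    | coe a => exact hP (by exact_mod_cast hab)

/-- A decreasing chain of subspaces starting from the whole space, no member of which is covered by
finitely many cosets of the next one. -/
structure IsThickChain (P : ℕ → Submodule F V) : Prop where
  zero : P 0 = ⊤
  antitone : Antitone P
  avoid : ∀ (n k : ℕ) (c : Fin k → V), ∃ y ∈ P n, ∀ i, y - c i ∉ P (n + 1)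

/-- If `n` is below every level in a finite set, some element of a given coset of `level P n` avoids
prescribed cosets of those levels. -/
theorem IsThickChain.exists_avoid {P : ℕ → Submodule F V} (hP : IsThickChain P) {ι : Type*}
    (s : Finset ι) (n : ℕ∞) (l : ι → ℕ∞) (hl : ∀ i ∈ s, n < l i) (b : V) (c : ι → V) :
    ∃ y, y - b ∈ level P n ∧ ∀ i ∈ s, y - c i ∉ level P (l i) := by
  induction n using ENat.recTopCoe with
  | top => exact ⟨b, by simp, fun i hi => absurd (hl i hi) (by simp)⟩
  | coe n =>
    obtain ⟨y, hy, h⟩ := hP.avoid n s.card (fun i => c (s.equivFin.symm i) - b)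
    refine ⟨y + b, by simpa using hy, fun i hi hmem => h (s.equivFin ⟨i, hi⟩) ?_⟩
    -- Every target subspace lies inside `P (n + 1)`, so it suffices to avoid cosets of `P (n + 1)`.
    have h1 : ((n + 1 : ℕ) : ℕ∞) ≤ l i := by
      have := Order.add_one_le_of_lt (hl i hi)
      exact_mod_cast this
    have h2 : _ ∈ P (n + 1) := level_antitone hP.antitone h1 hmem
    simpa [sub_sub_eq_add_sub] using h2

/-- The atomic relation `∑ i, ℓ i • v i ∈ level P n`, where `p = (ℓ, n)`. -/
def AtomHolds (P : ℕ → Submodule F V) {ι : Type*} [Fintype ι] (p : (ι → F) × ℕ∞) (v : ι → V) :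
    Prop :=
  ∑ i, p.1 i • v i ∈ level P p.2

/-- A relation which depends only on the truth values of finitely many atomic relations. -/
def Determined (P : ℕ → Submodule F V) {ι : Type*} [Fintype ι] (R : (ι → V) → Prop) : Prop :=
  ∃ S : Finset ((ι → F) × ℕ∞), ∀ v w : ι → V,
    (∀ p ∈ S, AtomHolds P p v ↔ AtomHolds P p w) → (R v ↔ R w)

variable {P : ℕ → Submodule F V}

theorem determined_atom {ι : Type*} [Fintype ι] (p : (ι → F) × ℕ∞) :
    Determined P (AtomHolds P p) :=
  ⟨{p}, fun _ _ h => h p (by simp)⟩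

theorem Determined.imp {ι : Type*} [Fintype ι] {R R' : (ι → V) → Prop} (h : Determined P R)
    (h' : Determined P R') : Determined P fun v => R v → R' v := by
  classical
  obtain ⟨S, hS⟩ := h
  obtain ⟨S', hS'⟩ := h'
  refine ⟨S ∪ S', fun v w hvw => ?_⟩
  exact imp_congr (hS v w fun p hp => hvw p (Finset.mem_union_left _ hp))
    (hS' v w fun p hp => hvw p (Finset.mem_union_right _ hp))

theorem Determined.comp_equiv {ι κ : Type*} [Fintype ι] [Fintype κ] (e : ι ≃ κ)
    {R : (ι → V) → Prop} (h : Determined P R) : Determined P fun v : κ → V => R (v ∘ e) := by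
  classical
  obtain ⟨S, hS⟩ := h
  refine ⟨S.image fun p => (p.1 ∘ e.symm, p.2), fun v w hvw => hS _ _ fun p hp => ?_⟩
  have := hvw _ (Finset.mem_image_of_mem _ hp)
  simpa [AtomHolds, ← e.sum_comp] using this

/-- Elimination of one quantifier: the variable `none` is projected away. -/
theorem Determined.all (hP : IsThickChain P) {ι : Type*} [Fintype ι] {R : (Option ι → V) → Prop}
    (h : Determined P R) :
    Determined P fun v : ι → V => ∀ x : V, R fun o => o.elim x v := by
  classical
  obtain ⟨S₀, hS₀⟩ := h
  -- This condition says `x ∈ P 0`, which always holds. It guarantees below that some listed coset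
  -- contains `x`.
  let triv : (Option ι → F) × ℕ∞ := (fun o => o.elim 1 0, 0)
  let S := insert triv S₀
  -- the center of the coset of `x` described by `p`
  let s : (Option ι → F) × ℕ∞ → ι → F := fun p i => -((p.1 none)⁻¹ * p.1 (some i))
  -- The first part records conditions not involving `x`; the second compares the centers of any two
  -- cosets at the level of either one.
  let S' : Finset ((ι → F) × ℕ∞) :=
    S.image (fun p => (fun i => p.1 (some i), p.2)) ∪
      (S ×ˢ S).image fun q => (fun i => s q.1 i - s q.2 i, q.2.2)
  have key : ∀ v w : ι → V, (∀ p ∈ S', AtomHolds P p v ↔ AtomHolds P p w) →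
      (∀ x : V, R fun o => o.elim x v) → ∀ x : V, R fun o => o.elim x w := by
    intro v w hvw hv x
    let c : (ι → V) → (Option ι → F) × ℕ∞ → V := fun v p => ∑ i, s p i • v i
    have hatom : ∀ p : (Option ι → F) × ℕ∞, p.1 none ≠ 0 → ∀ (u : ι → V) (x : V),
        (AtomHolds P p fun o => o.elim x u) ↔ x - c u p ∈ level P p.2 := by
      intro p hp u x
      have : ∑ o, p.1 o • (Option.elim o x u : V) = p.1 none • (x - c u p) := by
        simp [c, s, Finset.smul_sum, smul_smul, mul_inv_cancel_left₀ hp, Fintype.sum_option]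
      rw [AtomHolds, this, Submodule.smul_mem_iff _ hp]
    have hatom0 : ∀ p : (Option ι → F) × ℕ∞, p.1 none = 0 → ∀ (u : ι → V) (x : V),
        (AtomHolds P p fun o => o.elim x u) ↔
          AtomHolds P (fun i => p.1 (some i), p.2) u := by
      intro p hp u x
      simp [AtomHolds, Fintype.sum_option, hp]
    have hdiff : ∀ p ∈ S, ∀ q ∈ S,
        (c v p - c v q ∈ level P q.2 ↔ c w p - c w q ∈ level P q.2) := by
      intro p hp q hq
      have := hvw (fun i => s p i - s q i, q.2) (Finset.mem_union_right _
        (Finset.mem_image.2 ⟨(p, q), Finset.mk_mem_product hp hq, rfl⟩))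
      simpa [AtomHolds, sub_smul, Finset.sum_sub_distrib, c] using this
    let G := S.filter fun p => p.1 none ≠ 0 ∧ x - c w p ∈ level P p.2
    have htriv : triv ∈ G := by
      simp only [G, S, triv, Finset.mem_filter, Finset.mem_insert, true_or, true_and]
      refine ⟨one_ne_zero, ?_⟩
      change _ ∈ level P ((0 : ℕ) : ℕ∞)
      rw [level_coe, hP.zero]; trivial
    -- Among the cosets over `w` containing `x`, choose a deepest one. The matching `y` lies in the
    -- corresponding coset over `v` and avoids all deeper ones. At shallower or equal levels,
    -- membership depends only on differences of centers.
    obtain ⟨g, hg, hmax⟩ := G.exists_max_image (fun p => p.2) ⟨_, htriv⟩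
    obtain ⟨hgS, hg0, hgx⟩ := Finset.mem_filter.1 hg
    obtain ⟨y, hy, hya⟩ := hP.exists_avoid (S.filter fun p => g.2 < p.2) g.2 (fun p => p.2)
      (fun p hp => (Finset.mem_filter.1 hp).2) (c v g) (c v)
    refine (hS₀ (fun o => o.elim y v) (fun o => o.elim x w) fun p hp₀ => ?_).1 (hv y)
    have hp : p ∈ S := Finset.mem_insert_of_mem hp₀
    by_cases h0 : p.1 none = 0
    · rw [hatom0 p h0, hatom0 p h0]
      exact hvw _ (Finset.mem_union_left _ (Finset.mem_image_of_mem _ hp))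
    · rw [hatom p h0, hatom p h0]
      by_cases hlt : g.2 < p.2
      · refine iff_of_false (hya p (Finset.mem_filter.2 ⟨hp, hlt⟩)) fun hx => ?_
        exact absurd (hmax p (Finset.mem_filter.2 ⟨hp, h0, hx⟩)) (not_le.2 hlt)
      · have hle := level_antitone hP.antitone (not_lt.1 hlt)
        rw [← sub_add_sub_cancel y (c v g) (c v p), ← sub_add_sub_cancel x (c w g) (c w p),
          Submodule.add_mem_iff_right _ (hle hy), Submodule.add_mem_iff_right _ (hle hgx)]
        exact hdiff g hgS p hp
  exact ⟨S', fun v w hvw => ⟨key v w hvw, key w v fun p hp => (hvw p hp).symm⟩⟩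

theorem exists_term_realize_eq {ι : Type*} [Fintype ι] (t : (chainLanguage F).Term ι) :
    ∃ ℓ : ι → F, ∀ v : ι → V,
      (letI := chainStructure P; t.realize v) = ∑ i, ℓ i • v i := by
  classical
  let := chainStructure P
  induction t with
  | var i => exact ⟨Pi.single i 1, fun v => by simp [Pi.single_apply]⟩
  | func f ts ih =>
    choose ℓ hℓ using ih
    change ChainFunc F _ at f
    cases f with
    | zero => exact ⟨0, fun v => by simp [Term.realize, Structure.funMap]⟩
    | smul c =>
      exact ⟨fun i => c * ℓ 0 i, fun v => by
        simp [Term.realize, Structure.funMap, hℓ, Finset.smul_sum, smul_smul]⟩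
    | add =>
      exact ⟨fun i => ℓ 0 i + ℓ 1 i, fun v => by
        simp [Term.realize, Structure.funMap, hℓ, add_smul, Finset.sum_add_distrib]⟩
    | sub =>
      exact ⟨fun i => ℓ 0 i - ℓ 1 i, fun v => by
        simp [Term.realize, Structure.funMap, hℓ, sub_smul, Finset.sum_sub_distrib]⟩

/-- Quantifier elimination: every formula is a finite boolean combination of atomic relations. -/
theorem determined_boundedFormula (hP : IsThickChain P) {α : Type*} [Fintype α] {n : ℕ}
    (φ : (chainLanguage F).BoundedFormula α n) :
    Determined P fun v : α ⊕ Fin n → V =>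
      letI := chainStructure P; φ.Realize (v ∘ Sum.inl) (v ∘ Sum.inr) := by
  let := chainStructure P
  induction φ with
  | falsum => exact ⟨∅, fun _ _ _ => Iff.rfl⟩
  | equal t₁ t₂ =>
    obtain ⟨ℓ₁, h₁⟩ := exists_term_realize_eq (P := P) t₁
    obtain ⟨ℓ₂, h₂⟩ := exists_term_realize_eq (P := P) t₂
    convert determined_atom (P := P) (ℓ₁ - ℓ₂, ⊤) using 2 with v
    simp [BoundedFormula.Realize, AtomHolds, h₁, h₂, sub_smul, Finset.sum_sub_distrib, sub_eq_zero]
  | rel R ts =>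
    change ChainRel _ at R
    cases R with
    | P n =>
      obtain ⟨ℓ, h⟩ := exists_term_realize_eq (P := P) (ts 0)
      convert determined_atom (P := P) (ℓ, (n : ℕ∞)) using 2 with v
      simp [BoundedFormula.Realize, AtomHolds, h, Structure.RelMap]
  | imp _ _ ih₁ ih₂ => exact ih₁.imp ih₂
  | @all n φ ih =>
    let e : α ⊕ Fin (n + 1) ≃ Option (α ⊕ Fin n) :=
      { toFun := Sum.elim (fun a => some (.inl a))
          (Fin.lastCases none fun i => some (.inr i))
        invFun := fun o => o.elim (.inr (Fin.last n)) (Sum.map id Fin.castSucc)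
        left_inv := by
          rintro (a | i)
          · rfl
          · induction i using Fin.lastCases <;> simp
        right_inv := by rintro (_ | a | i) <;> simp }
    convert (ih.comp_equiv e).all hP using 2 with v
    refine forall_congr' fun x => ?_
    congr! 1
    · ext i
      induction i using Fin.lastCases <;> simp [e]

theorem determined_formula (hP : IsThickChain P) {α : Type*} [Fintype α]
    (φ : (chainLanguage F).Formula α) :
    Determined P fun v : α → V => letI := chainStructure P; φ.Realize v := by
  let := chainStructure P
  convert (determined_boundedFormula hP φ).comp_equiv (Equiv.sumEmpty α (Fin 0)) using 2 with v
  simp only [Formula.Realize]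
  congr! 1

end Elimination

/-! ### No order property, and no independent pattern with more rows than variables -/

section Combinatorics

variable {F : Type u} [Field F] {V : Type v} [AddCommGroup V] [Module F V]
  {P : ℕ → Submodule F V}

theorem atomHolds_sumElim {ι κ : Type*} [Fintype ι] [Fintype κ] (p : (ι ⊕ κ → F) × ℕ∞)
    (x : ι → V) (y : κ → V) :
    AtomHolds P p (Sum.elim x y) ↔
      ∑ i, p.1 (.inl i) • x i + ∑ i, p.1 (.inr i) • y i ∈ level P p.2 := by
  simp [AtomHolds, Fintype.sum_sum_type]

/-- Iterated ultrafilter limits of the relation `f i + g j ∈ H` do not depend on the order. -/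
theorem eventually_eventually_add_mem_comm {ι : Type*} (U : Ultrafilter ι) (H : Submodule F V)
    (f g : ι → V) (h : ∀ᶠ i in U, ∀ᶠ j in U, f i + g j ∈ H) :
    ∀ᶠ j in U, ∀ᶠ i in U, f i + g j ∈ H := by
  by_contra hn
  rw [← Ultrafilter.eventually_not] at hn
  -- Choose a rectangle `i, i'`, `j, j'` with three sums in `H` and the fourth, `f i' + g j`,
  -- outside. The three force the fourth into `H`.
  obtain ⟨i, hi⟩ := h.exists
  obtain ⟨j, hj, hij⟩ := (hn.and hi).exists
  rw [← Ultrafilter.eventually_not] at hj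
  obtain ⟨i', hi', hij'⟩ := (h.and hj).exists
  obtain ⟨j', h1, h2⟩ := (hi.and hi').exists
  apply hij'
  have : f i' + g j = (f i' + g j') - (f i + g j') + (f i + g j) := by abel
  rw [this]
  exact H.add_mem (H.sub_mem h2 h1) hij

theorem eventually_eventually_add_mem_iff {ι : Type*} (U : Ultrafilter ι) (H : Submodule F V)
    (f g : ι → V) :
    (∀ᶠ i in U, ∀ᶠ j in U, f i + g j ∈ H) ↔ ∀ᶠ j in U, ∀ᶠ i in U, f i + g j ∈ H := by
  refine ⟨eventually_eventually_add_mem_comm U H f g, fun h => ?_⟩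
  simp_rw [add_comm (f _)] at h ⊢
  exact eventually_eventually_add_mem_comm U H g f h

/-- A determined relation does not have the order property. -/
theorem Determined.not_orderProperty {m n : ℕ} {R : (Fin m ⊕ Fin n → V) → Prop}
    (hR : Determined P R) (a : ℕ → Fin m → V) (b : ℕ → Fin n → V)
    (h : ∀ i j : ℕ, R (Sum.elim (a i) (b j)) ↔ i < j) : False := by
  obtain ⟨S, hS⟩ := hR
  let U : Ultrafilter ℕ := Filter.hyperfilter ℕ
  have hgt : ∀ i, ∀ᶠ j in U, i < j := fun i =>
    (Filter.eventually_gt_atTop i).filter_mono Nat.hyperfilter_le_atTop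
  let τ : (Fin m ⊕ Fin n → F) × ℕ∞ → Prop := fun p =>
    ∀ᶠ i in U, ∀ᶠ j in U, AtomHolds P p (Sum.elim (a i) (b j))
  have e1 : ∀ᶠ i in U, ∀ᶠ j in U, ∀ p ∈ S, AtomHolds P p (Sum.elim (a i) (b j)) ↔ τ p := by
    simp_rw [Filter.eventually_all_finset]
    intro p _
    by_cases hp : τ p
    · simp only [hp, iff_true]; exact hp
    · simp only [hp, iff_false, Ultrafilter.eventually_not]; exact hp
  have e2 : ∀ᶠ j in U, ∀ᶠ i in U, ∀ p ∈ S, AtomHolds P p (Sum.elim (a i) (b j)) ↔ τ p := by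
    simp_rw [Filter.eventually_all_finset]
    intro p _
    have hτ : τ p ↔ ∀ᶠ j in U, ∀ᶠ i in U, AtomHolds P p (Sum.elim (a i) (b j)) := by
      simp_rw [τ, atomHolds_sumElim]
      exact eventually_eventually_add_mem_iff U _ _ _
    by_cases hp : τ p
    · simpa [hp] using hτ.1 hp
    · simpa [hp, ← Ultrafilter.eventually_not] using mt hτ.2 hp
  -- Both orders of limit give the same atomic type `τ`. One yields a pair with `i < j`, the other a
  -- pair with `j' < i'`, and `R` cannot tell them apart.
  obtain ⟨i, hi⟩ := e1.exists
  obtain ⟨j, hij, hlt⟩ := (hi.and (hgt i)).exists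
  obtain ⟨j', hj'⟩ := e2.exists
  obtain ⟨i', hij', hlt'⟩ := (hj'.and (hgt j')).exists
  have := hS _ _ fun p hp => (hij p hp).trans (hij' p hp).symm
  rw [h, h] at this
  omega

/-- Finitely many equivalence relations are simultaneously trivial or discrete on some infinite
set. -/
theorem exists_infinite_trivial_or_discrete {Λ ι : Type*} [Infinite Λ] (r : ι → Setoid Λ)
    (S : Finset ι) :
    ∃ A : Set Λ, A.Infinite ∧ ∀ i ∈ S,
      (∀ a ∈ A, ∀ b ∈ A, r i a b) ∨ ∀ a ∈ A, ∀ b ∈ A, r i a b → a = b := by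
  classical
  induction S using Finset.induction_on with
  | empty => exact ⟨Set.univ, Set.infinite_univ, by simp⟩
  | insert i S _ ih =>
    obtain ⟨A, hA, h⟩ := ih
    suffices ∃ B ⊆ A, B.Infinite ∧
        ((∀ a ∈ B, ∀ b ∈ B, r i a b) ∨ ∀ a ∈ B, ∀ b ∈ B, r i a b → a = b) by
      obtain ⟨B, hBA, hB, hi⟩ := this
      refine ⟨B, hB, fun j hj => ?_⟩
      rcases Finset.mem_insert.1 hj with rfl | hj
      · exact hi
      · exact (h j hj).imp (fun h a ha b hb => h a (hBA ha) b (hBA hb))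
          fun h a ha b hb => h a (hBA ha) b (hBA hb)
    let q : Λ → Quotient (r i) := Quotient.mk _
    -- With infinitely many classes, take a transversal; with finitely many, one class is infinite.
    by_cases hq : (q '' A).Infinite
    · obtain ⟨B, hBA, hB⟩ := (Set.surjOn_image q A).exists_bijOn_subset
      refine ⟨B, hBA, fun hf => hq (hB.image_eq ▸ hf.image q), .inr fun a ha b hb hab => ?_⟩
      exact hB.injOn ha hb (Quotient.sound hab)
    · have : ∃ c, (A ∩ q ⁻¹' {c}).Infinite := by
        by_contra hc
        push Not at hc
        exact hA (Set.Finite.of_finite_fibers q (Set.not_infinite.1 hq) fun c _ => hc c)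
      obtain ⟨c, hc⟩ := this
      refine ⟨_, Set.inter_subset_left, hc, .inl fun a ha b hb => ?_⟩
      exact Quotient.exact ((ha.2 : q a = c).trans (hb.2 : q b = c).symm)

/-- For more linear forms than variables, one of the subspaces `ℓ_i ∈ level P n_i` contains the
intersection of the other ones. -/
theorem exists_mem_level_of_forall_ne (hP : Antitone P) {m : ℕ} (ℓ : Fin (m + 1) → Fin m → F)
    (n : Fin (m + 1) → ℕ∞) :
    ∃ i, ∀ d : Fin m → V, (∀ j, j ≠ i → ∑ k, ℓ j k • d k ∈ level P (n j)) →
      ∑ k, ℓ i k • d k ∈ level P (n i) := by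
  classical
  have hdep : ¬ LinearIndependent F ℓ := fun h => by
    have := h.fintype_card_le_finrank
    simp at this
  obtain ⟨g, hg, j₀, hj₀⟩ := Fintype.not_linearIndependent_iff.1 hdep
  -- The least level gives the largest subspace, which contains all the other terms of the
  -- dependence relation.
  obtain ⟨i, hi, hmin⟩ := (Finset.univ.filter fun j => g j ≠ 0).exists_min_image n
    ⟨j₀, by simpa using hj₀⟩
  have hgi : g i ≠ 0 := (Finset.mem_filter.1 hi).2
  refine ⟨i, fun d hd => (Submodule.smul_mem_iff _ hgi).1 ?_⟩
  have hsum : ∑ j, g j • ∑ k, ℓ j k • d k = 0 := by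
    simp_rw [Finset.smul_sum, smul_smul]
    rw [Finset.sum_comm]
    refine Finset.sum_eq_zero fun k _ => ?_
    rw [← Finset.sum_smul]
    have := congrFun hg k
    simp only [Finset.sum_apply, Pi.smul_apply, smul_eq_mul, Pi.zero_apply] at this
    rw [this, zero_smul]
  rw [← Finset.add_sum_erase _ _ (Finset.mem_univ i)] at hsum
  rw [eq_neg_of_add_eq_zero_left hsum]
  refine Submodule.neg_mem _ (Submodule.sum_mem _ fun j hj => ?_)
  by_cases hgj : g j = 0
  · simp [hgj]
  · exact Submodule.smul_mem _ _ (level_antitone hP (hmin j (by simpa using hgj))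
      (hd j (Finset.ne_of_mem_erase hj)))

/-- The equivalence relation on indices of parameters induced by an atomic relation. -/
def paramSetoid (P : ℕ → Submodule F V) {ι κ Λ : Type*} [Fintype κ] (y : Λ → κ → V)
    (p : (ι ⊕ κ → F) × ℕ∞) : Setoid Λ where
  r a b := ∑ i, p.1 (.inr i) • y a i - ∑ i, p.1 (.inr i) • y b i ∈ level P p.2
  iseqv :=
    { refl := fun a => by simp
      symm := fun h => by simpa using Submodule.neg_mem _ h
      trans := fun h h' => by simpa using Submodule.add_mem _ h h' }

theorem paramSetoid_of_atomHolds {ι κ Λ : Type*} [Fintype ι] [Fintype κ] {y : Λ → κ → V}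
    {p : (ι ⊕ κ → F) × ℕ∞} {x : ι → V} {a b : Λ} (ha : AtomHolds P p (Sum.elim x (y a)))
    (hb : AtomHolds P p (Sum.elim x (y b))) : paramSetoid P y p a b := by
  rw [atomHolds_sumElim] at ha hb
  have := Submodule.sub_mem _ ha hb
  rwa [add_sub_add_left_eq_sub] at this

theorem atomHolds_iff_of_paramSetoid {ι κ Λ : Type*} [Fintype ι] [Fintype κ] {y : Λ → κ → V}
    {p : (ι ⊕ κ → F) × ℕ∞} (x : ι → V) {a b : Λ} (h : paramSetoid P y p a b) :
    AtomHolds P p (Sum.elim x (y a)) ↔ AtomHolds P p (Sum.elim x (y b)) := by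
  rw [atomHolds_sumElim, atomHolds_sumElim]
  rw [← sub_add_cancel (∑ i, p.1 (.inr i) • y a i) (∑ i, p.1 (.inr i) • y b i), add_left_comm]
  exact Submodule.add_mem_iff_right _ h

/-- In a row of an independent pattern, one of the atomic relations holding at the selected
parameter separates the parameters of the row. -/
theorem exists_separating_atom {ι κ : Type*} [Fintype ι] [Fintype κ] {R : (ι ⊕ κ → V) → Prop}
    {S : Finset ((ι ⊕ κ → F) × ℕ∞)}
    (hS : ∀ v w : ι ⊕ κ → V, (∀ p ∈ S, AtomHolds P p v ↔ AtomHolds P p w) → (R v ↔ R w))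
    (y : ℕ → κ → V)
    (hy : ∀ p ∈ S, (∀ a b, paramSetoid P y p a b) ∨ ∀ a b, paramSetoid P y p a b → a = b)
    (x : ι → V) (a : ℕ) (h : ∀ b, R (Sum.elim x (y b)) ↔ a = b) :
    ∃ p ∈ S, (∀ a b, paramSetoid P y p a b → a = b) ∧ AtomHolds P p (Sum.elim x (y a)) := by
  classical
  by_contra! hc
  -- Each discrete atom holds for at most one parameter. Off the finite set `B` all of them fail, as
  -- they do at `a` by assumption, and trivial atoms never distinguish parameters. Hence `R` cannot
  -- separate `a` from some `b ≠ a`.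
  let B : Set ℕ := ⋃ p ∈ S, {b | (∀ a b, paramSetoid P y p a b → a = b) ∧
    AtomHolds P p (Sum.elim x (y b))}
  have hB : B.Finite := S.finite_toSet.biUnion fun p _ => Set.Subsingleton.finite
    fun b hb b' hb' => hb.1 _ _ (paramSetoid_of_atomHolds hb.2 hb'.2)
  obtain ⟨b, hb⟩ := (hB.insert a).exists_notMem
  rw [Set.mem_insert_iff, not_or] at hb
  refine hb.1 ((h b).1 ((hS _ _ fun p hp => ?_).1 ((h a).2 rfl))).symm
  rcases hy p hp with h1 | h1
  · exact atomHolds_iff_of_paramSetoid x (h1 a b)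
  · refine iff_of_false (hc p hp h1) fun h2 => hb.2 ?_
    exact Set.mem_biUnion hp ⟨h1, h2⟩

/-- Determined relations in `m` variables have no independent pattern of depth `m + 1`. -/
theorem not_independentPattern (hP : Antitone P) {m : ℕ} {n : Fin (m + 1) → ℕ}
    {R : ∀ i, (Fin m ⊕ Fin (n i) → V) → Prop} (hR : ∀ i, Determined P (R i)) {Λ : Type*}
    [Infinite Λ] (x : (Fin (m + 1) → Λ) → Fin m → V) (y : ∀ i, Λ → Fin (n i) → V)
    (h : ∀ η i α, R i (Sum.elim (x η) (y i α)) ↔ η i = α) : False := by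
  classical
  choose S hS using hR
  have hA := fun i => exists_infinite_trivial_or_discrete (paramSetoid P (ι := Fin m) (y i)) (S i)
  choose A hAinf hA using hA
  have := fun i => (hAinf i).to_subtype
  let e : ∀ i, ℕ ↪ A i := fun i => Infinite.natEmbedding (A i)
  let y' : ∀ i, ℕ → Fin (n i) → V := fun i k => y i (e i k)
  -- Colour each path `η` by its separating atoms, one per row. As `N` exceeds the number of
  -- colours, some colour is used by more than `N ^ m` of the `N ^ (m + 1)` paths.
  let N : ℕ := Fintype.card (∀ i, S i) + 1
  let x' : (Fin (m + 1) → Fin N) → Fin m → V := fun η => x fun i => e i (η i)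
  have hsep : ∀ η i, ∃ p : S i, (∀ a b, paramSetoid P (y' i) p.1 a b → a = b) ∧
      AtomHolds P p.1 (Sum.elim (x' η) (y' i (η i))) := by
    intro η i
    have h1 : ∀ p ∈ S i, (∀ a b, paramSetoid P (y' i) p a b) ∨
        ∀ a b, paramSetoid P (y' i) p a b → a = b := fun p hp => by
      refine (hA i p hp).imp (fun h a b => h _ (e i a).2 _ (e i b).2) fun h a b hab => ?_
      exact (e i).injective (Subtype.ext (h _ (e i a).2 _ (e i b).2 hab))
    have h2 : ∀ b : ℕ, R i (Sum.elim (x' η) (y' i b)) ↔ (η i : ℕ) = b := fun b => by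
      simp only [x', y', h]
      rw [← Subtype.ext_iff, (e i).injective.eq_iff]
    obtain ⟨p, hp, hpi, hpa⟩ := exists_separating_atom (hS i) (y' i) h1 (x' η) (η i) h2
    exact ⟨⟨p, hp⟩, hpi, hpa⟩
  choose χ hinj hχ using hsep
  obtain ⟨c, hc⟩ := Fintype.exists_lt_card_fiber_of_mul_lt_card (f := χ) (n := N ^ m) (by
    rw [Fintype.card_fun, Fintype.card_fin, Fintype.card_fin, pow_succ']
    exact Nat.mul_lt_mul_of_pos_right (Nat.lt_succ_self _) (pow_pos (Nat.succ_pos _) _))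
  obtain ⟨i, hi⟩ := exists_mem_level_of_forall_ne (V := V) hP
    (fun j k => (c j).1.1 (.inl k)) fun j => (c j).1.2
  refine absurd hc (not_lt.2 ?_)
  have hcard : N ^ m = Fintype.card (Fin m → Fin N) := by simp
  rw [hcard]
  -- Within one colour a path is determined by its entries off `i`. If two paths agree there, the
  -- difference of their `x'` satisfies the other conditions, hence also the `i`-th, which makes the
  -- two parameters in row `i` equivalent and so equal.
  refine Finset.card_le_card_of_injOn (fun η => i.removeNth η) (fun _ _ => Finset.mem_coe.2
    (Finset.mem_univ _)) ?_
  intro η hη η' hη' heq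
  replace hη : χ η = c := by simpa using hη
  replace hη' : χ η' = c := by simpa using hη'
  have hne : ∀ j, j ≠ i → η j = η' j := by
    intro j hj
    obtain ⟨k, rfl⟩ := Fin.exists_succAbove_eq hj
    exact congrFun heq k
  have hmem : ∀ j, ∑ k, (c j).1.1 (.inl k) • x' η k + ∑ k, (c j).1.1 (.inr k) • y' j (η j) k ∈
      level P (c j).1.2 := fun j => by
    have := hχ η j
    rwa [hη, atomHolds_sumElim] at this
  have hmem' : ∀ j, ∑ k, (c j).1.1 (.inl k) • x' η' k +
      ∑ k, (c j).1.1 (.inr k) • y' j (η' j) k ∈ level P (c j).1.2 := fun j => by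
    have := hχ η' j
    rwa [hη', atomHolds_sumElim] at this
  have hd := hi (x' η - x' η') fun j hj => by
    have := Submodule.sub_mem _ (hmem j) (hmem' j)
    rw [hne j hj, add_sub_add_right_eq_sub] at this
    simpa [smul_sub, Finset.sum_sub_distrib] using this
  have hy : paramSetoid P (y' i) (c i).1 (η i) (η' i) := by
    have := Submodule.sub_mem _ (Submodule.sub_mem _ (hmem i) (hmem' i)) hd
    simp only [Pi.sub_apply, smul_sub, Finset.sum_sub_distrib] at this
    rwa [add_sub_add_comm, add_sub_cancel_left] at this
  funext j
  by_cases hj : j = i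
  · subst hj
    have := hinj η j
    rw [hη] at this
    exact Fin.ext (this _ _ hy)
  · exact hne j hj

end Combinatorics

/-! ### Models of the theory are thick chains -/

section Axiomatization

variable {F : Type u}

/-- The term `0`. -/
def zeroTerm (F : Type u) (α : Type*) : (chainLanguage F).Term α :=
  Constants.term (L := chainLanguage F) ChainFunc.zero

/-- The term `c t`. -/
def smulTerm {α : Type*} (c : F) (t : (chainLanguage F).Term α) : (chainLanguage F).Term α :=
  Functions.apply₁ (L := chainLanguage F) (ChainFunc.smul c) t

/-- The term `s + t`. -/
def addTerm {α : Type*} (s t : (chainLanguage F).Term α) : (chainLanguage F).Term α :=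
  Functions.apply₂ (L := chainLanguage F) ChainFunc.add s t

/-- The term `s - t`. -/
def subTerm {α : Type*} (s t : (chainLanguage F).Term α) : (chainLanguage F).Term α :=
  Functions.apply₂ (L := chainLanguage F) ChainFunc.sub s t

/-- The formula `P_n t`. -/
def memFormula {α : Type*} {k : ℕ} (n : ℕ) (t : (chainLanguage F).Term (α ⊕ Fin k)) :
    (chainLanguage F).BoundedFormula α k :=
  Relations.boundedFormula₁ (L := chainLanguage F) (ChainRel.P n) t

section Structure

variable {M : Type w} [(chainLanguage F).Structure M]

/-- The interpretation of `0`. -/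
def opZero (F : Type u) (M : Type w) [(chainLanguage F).Structure M] : M :=
  Structure.funMap (L := chainLanguage F) ChainFunc.zero ![]

/-- The interpretation of `c x`. -/
def opSmul (c : F) (a : M) : M :=
  Structure.funMap (L := chainLanguage F) (ChainFunc.smul c) ![a]

/-- The interpretation of `x + y`. -/
def opAdd (F : Type u) {M : Type w} [(chainLanguage F).Structure M] (a b : M) : M :=
  Structure.funMap (L := chainLanguage F) ChainFunc.add ![a, b]

/-- The interpretation of `x - y`. -/
def opSub (F : Type u) {M : Type w} [(chainLanguage F).Structure M] (a b : M) : M :=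
  Structure.funMap (L := chainLanguage F) ChainFunc.sub ![a, b]

/-- The interpretation of `P_n`. -/
def opMem (F : Type u) {M : Type w} [(chainLanguage F).Structure M] (n : ℕ) (a : M) : Prop :=
  Structure.RelMap (L := chainLanguage F) (ChainRel.P n) ![a]

variable {α : Type*} (v : α → M) (s t : (chainLanguage F).Term α)

@[simp] theorem realize_zeroTerm : (zeroTerm F α).realize v = opZero F M := by
  exact congrArg (Structure.funMap (L := chainLanguage F) ChainFunc.zero) (Subsingleton.elim _ _)

@[simp] theorem realize_smulTerm (c : F) :
    (smulTerm c t).realize v = opSmul c (t.realize v) := Term.realize_functions_apply₁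

@[simp] theorem realize_addTerm :
    (addTerm s t).realize v = opAdd F (s.realize v) (t.realize v) := Term.realize_functions_apply₂

@[simp] theorem realize_subTerm :
    (subTerm s t).realize v = opSub F (s.realize v) (t.realize v) := Term.realize_functions_apply₂

@[simp] theorem realize_memFormula {k : ℕ} (n : ℕ) (t : (chainLanguage F).Term (α ⊕ Fin k))
    (xs : Fin k → M) :
    (memFormula n t).Realize v xs ↔ opMem F n (t.realize (Sum.elim v xs)) :=
  BoundedFormula.realize_rel₁

end Structure

variable [Field F] {V : Type v} [AddCommGroup V] [Module F V] {P : ℕ → Submodule F V}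

/-- A formula valid in the standard structure is valid in all models of its theory. -/
theorem realize_of_forall_realize {M : Type w} [(chainLanguage F).Structure M]
    [M ⊨ chainTheory P] {k : ℕ} (φ : (chainLanguage F).Formula (Fin k))
    (h : ∀ v : Fin k → V, let := chainStructure P; φ.Realize v) (v : Fin k → M) :
    φ.Realize v := by
  let := chainStructure P
  let ψ : (chainLanguage F).Sentence :=
    (BoundedFormula.relabel (Sum.inr : Fin k → Empty ⊕ Fin k) φ).alls
  have hψ : ψ ∈ chainTheory P := by
    refine mem_completeTheory.2 (BoundedFormula.realize_alls.2 fun xs => ?_)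
    exact Formula.realize_relabel_sumInr φ |>.2 (h xs)
  exact Formula.realize_relabel_sumInr φ |>.1
    (BoundedFormula.realize_alls.1 ((chainTheory P).realize_sentence_of_mem hψ (M := M)) v)

theorem realize_eq_of_forall_realize_eq {M : Type w} [(chainLanguage F).Structure M]
    [M ⊨ chainTheory P] {k : ℕ} (s t : (chainLanguage F).Term (Fin k))
    (h : ∀ v : Fin k → V, let := chainStructure P; s.realize v = t.realize v) (v : Fin k → M) :
    s.realize v = t.realize v :=
  Formula.realize_equal.1 (realize_of_forall_realize (P := P) (s.equal t)
    (fun v => by let := chainStructure P; exact Formula.realize_equal.2 (h v)) v)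

section Standard

variable (P)

theorem opZero_chainStructure : (let := chainStructure P; opZero F V) = 0 := rfl
theorem opSmul_chainStructure (c : F) (a : V) :
    (let := chainStructure P; opSmul c a) = c • a := rfl
theorem opAdd_chainStructure (a b : V) : (let := chainStructure P; opAdd F a b) = a + b := rfl
theorem opSub_chainStructure (a b : V) : (let := chainStructure P; opSub F a b) = a - b := rfl
theorem opMem_chainStructure (n : ℕ) (a : V) :
    (let := chainStructure P; opMem F n a) ↔ a ∈ P n := Iff.rfl

end Standard

/-- Every model of the theory of a thick chain is a vector space with a thick chain. -/
theorem exists_eq_chainStructure (hP : IsThickChain P) (M : Type w)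
    [inst : (chainLanguage F).Structure M] [M ⊨ chainTheory P] :
    ∃ (_ : AddCommGroup M) (_ : Module F M) (Q : ℕ → Submodule F M),
      IsThickChain Q ∧ inst = chainStructure Q := by
  have E := fun {k : ℕ} => realize_eq_of_forall_realize_eq (P := P) (M := M) (k := k)
  have E' := fun {k : ℕ} => realize_of_forall_realize (P := P) (M := M) (k := k)
  have hcomm : ∀ a b : M, opAdd F a b = opAdd F b a := fun a b => by
    have := E (addTerm (.var 0) (.var 1)) (addTerm (.var 1) (.var 0)) (fun v => by
      simp [opAdd_chainStructure, add_comm]) ![a, b]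
    simpa using this
  have hassoc : ∀ a b c : M, opAdd F (opAdd F a b) c = opAdd F a (opAdd F b c) := fun a b c => by
    have := E (addTerm (addTerm (.var 0) (.var 1)) (.var 2))
      (addTerm (.var 0) (addTerm (.var 1) (.var 2))) (fun v => by
        simp [opAdd_chainStructure, add_assoc]) ![a, b, c]
    simpa using this
  have hzero : ∀ a : M, opAdd F (opZero F M) a = a := fun a => by
    have := E (addTerm (zeroTerm F _) (.var 0)) (.var 0) (fun v => by
      simp [opAdd_chainStructure, opZero_chainStructure]) ![a]
    simpa using this
  have hneg : ∀ a : M, opAdd F (opSmul (-1 : F) a) a = opZero F M := fun a => by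
    have := E (addTerm (smulTerm (-1) (.var 0)) (.var 0)) (zeroTerm F _) (fun v => by
      simp [opAdd_chainStructure, opZero_chainStructure, opSmul_chainStructure]) ![a]
    simpa using this
  have hsub : ∀ a b : M, opSub F a b = opAdd F a (opSmul (-1 : F) b) := fun a b => by
    have := E (subTerm (.var 0) (.var 1)) (addTerm (.var 0) (smulTerm (-1) (.var 1))) (fun v => by
      simp [opAdd_chainStructure, opSub_chainStructure, opSmul_chainStructure, sub_eq_add_neg])
      ![a, b]
    simpa using this
  have hone : ∀ a : M, opSmul (1 : F) a = a := fun a => by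
    have := E (smulTerm 1 (.var 0)) (.var 0) (fun v => by simp [opSmul_chainStructure]) ![a]
    simpa using this
  have hmul : ∀ (c d : F) (a : M), opSmul (c * d) a = opSmul c (opSmul d a) := fun c d a => by
    have := E (smulTerm (c * d) (.var 0)) (smulTerm c (smulTerm d (.var 0))) (fun v => by
      simp [opSmul_chainStructure, mul_smul]) ![a]
    simpa using this
  have hsmul_zero : ∀ c : F, opSmul c (opZero F M) = opZero F M := fun c => by
    have := E (k := 0) (smulTerm c (zeroTerm F _)) (zeroTerm F _) (fun v => by
      simp [opSmul_chainStructure, opZero_chainStructure]) ![]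
    simpa using this
  have hsmul_add : ∀ (c : F) (a b : M),
      opSmul c (opAdd F a b) = opAdd F (opSmul c a) (opSmul c b) := fun c a b => by
    have := E (smulTerm c (addTerm (.var 0) (.var 1)))
      (addTerm (smulTerm c (.var 0)) (smulTerm c (.var 1))) (fun v => by
        simp [opSmul_chainStructure, opAdd_chainStructure]) ![a, b]
    simpa using this
  have hadd_smul : ∀ (c d : F) (a : M),
      opSmul (c + d) a = opAdd F (opSmul c a) (opSmul d a) := fun c d a => by
    have := E (smulTerm (c + d) (.var 0)) (addTerm (smulTerm c (.var 0)) (smulTerm d (.var 0)))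
      (fun v => by simp [opSmul_chainStructure, opAdd_chainStructure, add_smul]) ![a]
    simpa using this
  have hzero_smul : ∀ a : M, opSmul (0 : F) a = opZero F M := fun a => by
    have := E (smulTerm 0 (.var 0)) (zeroTerm F _)
      (fun v => by simp [opSmul_chainStructure, opZero_chainStructure]) ![a]
    simpa using this
  have mem_add : ∀ n (a b : M), opMem F n a → opMem F n b → opMem F n (opAdd F a b) :=
    fun n a b => by
      have := E' ((memFormula n (.var (.inl 0))).imp ((memFormula n (.var (.inl 1))).imp
        (memFormula n (addTerm (.var (.inl 0)) (.var (.inl 1)))))) (fun v => by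
          simpa [Formula.Realize, opMem_chainStructure, opAdd_chainStructure] using
            fun h h' => (P n).add_mem h h') ![a, b]
      simpa [Formula.Realize] using this
  have mem_smul : ∀ n (c : F) (a : M), opMem F n a → opMem F n (opSmul c a) := fun n c a => by
    have := E' ((memFormula n (.var (.inl 0))).imp (memFormula n (smulTerm c (.var (.inl 0)))))
      (fun v => by
        simpa [Formula.Realize, opMem_chainStructure, opSmul_chainStructure] using
            fun h => (P n).smul_mem c h) ![a]
    simpa [Formula.Realize] using this
  have mem_zero : ∀ n, opMem F n (opZero F M) := fun n => by
    have := E' (k := 0) (memFormula n (zeroTerm F _)) (fun v => by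
      simp [Formula.Realize, opMem_chainStructure, opZero_chainStructure]) ![]
    simpa [Formula.Realize] using this
  have mem_level_zero : ∀ a : M, opMem F 0 a := fun a => by
    have := E' (memFormula 0 (.var (.inl 0))) (fun v => by
      simp [Formula.Realize, opMem_chainStructure, hP.zero]) ![a]
    simpa [Formula.Realize] using this
  have mem_succ : ∀ n (a : M), opMem F (n + 1) a → opMem F n a := fun n a => by
    have := E' ((memFormula (n + 1) (.var (.inl 0))).imp (memFormula n (.var (.inl 0))))
      (fun v => by
        simpa [Formula.Realize, opMem_chainStructure] using
            fun h => hP.antitone n.le_succ h) ![a]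
    simpa [Formula.Realize] using this
  -- For fixed `n` and `k`, avoiding `k` cosets is a single first-order sentence in the parameters
  -- `c`. This is why thickness is stated with finite tuples rather than dimensions.
  have havoid : ∀ n k (c : Fin k → M),
      ∃ y : M, opMem F n y ∧ ∀ i, ¬ opMem F (n + 1) (opSub F y (c i)) := fun n k c => by
    have := E' (k := k) ((memFormula n (.var (.inr 0)) ⊓ BoundedFormula.iInf fun i : Fin k =>
      (memFormula (n + 1) (subTerm (.var (.inr 0)) (.var (.inl i)))).not).ex) (fun v => by
        simpa [Formula.Realize, opMem_chainStructure, opSub_chainStructure, Fin.snoc] using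
          hP.avoid n k v) c
    simpa [Formula.Realize, Fin.snoc] using this
  let instG : AddCommGroup M :=
    { add := opAdd F
      add_assoc := hassoc
      zero := opZero F M
      zero_add := hzero
      add_zero := fun a => (hcomm _ _).trans (hzero a)
      neg := opSmul (-1 : F)
      sub := opSub F
      sub_eq_add_neg := hsub
      neg_add_cancel := hneg
      add_comm := hcomm
      nsmul := @nsmulRec M ⟨opZero F M⟩ ⟨opAdd F⟩
      zsmul := @zsmulRec M ⟨opZero F M⟩ ⟨opAdd F⟩ ⟨opSmul (-1 : F)⟩
        (@nsmulRec M ⟨opZero F M⟩ ⟨opAdd F⟩) }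
  let instM : Module F M :=
    { smul := opSmul
      one_smul := hone
      mul_smul := hmul
      smul_zero := hsmul_zero
      smul_add := hsmul_add
      add_smul := hadd_smul
      zero_smul := hzero_smul }
  let Q : ℕ → Submodule F M := fun n =>
    { carrier := {a | opMem F n a}
      add_mem' := mem_add n _ _
      zero_mem' := mem_zero n
      smul_mem' := mem_smul n }
  refine ⟨instG, instM, Q, ⟨?_, antitone_nat_of_succ_le fun n a => mem_succ n a, havoid⟩, ?_⟩
  · exact eq_top_iff.2 fun a _ => mem_level_zero a
  · refine Structure.ext (funext fun k => funext fun f => funext fun x => ?_)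
      (funext fun k => funext fun r => funext fun x => ?_)
    · change ChainFunc F k at f
      cases f with
      | zero =>
        exact congrArg (Structure.funMap (L := chainLanguage F) ChainFunc.zero)
          (Subsingleton.elim _ _)
      | smul c =>
        exact congrArg (Structure.funMap (L := chainLanguage F) (ChainFunc.smul c))
          -- Only the form of the argument tuple differs; its list of entries is the same.
          (List.ofFn_injective rfl : x = ![x 0])
      | add =>
        exact congrArg (Structure.funMap (L := chainLanguage F) ChainFunc.add)
          (List.ofFn_injective rfl : x = ![x 0, x 1])
      | sub =>
        exact congrArg (Structure.funMap (L := chainLanguage F) ChainFunc.sub)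
          (List.ofFn_injective rfl : x = ![x 0, x 1])
    · change ChainRel k at r
      cases r with
      | P n =>
        exact congrArg (Structure.RelMap (L := chainLanguage F) (ChainRel.P n))
          (List.ofFn_injective rfl : x = ![x 0])

end Axiomatization

/-! ### Stability and strong¹ dependence of the theory -/

section Ranks

/-- Give each row its own coordinate of `x` and use equality as the formula. This provides the lower
bound `ℵ₀` for `kappaIct`. -/
theorem witnessIct_of_finite {L : FirstOrder.Language.{u, 0}} (T : L.Theory)
    (M : Theory.ModelType.{u, 0, u} T) [Infinite M] (I : Type u) [Finite I] :
    ∃ (m : ℕ) (n : I → ℕ) (φ : ∀ i, L.Formula (Fin m ⊕ Fin (n i))),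
      WitnessIct T φ := by
  obtain ⟨m, ⟨e⟩⟩ := Finite.exists_equiv_fin I
  refine ⟨m, fun _ => 1, fun i => Term.equal (.var (.inl (e i))) (.var (.inr 0)), M,
    inferInstance, M, fun η k => η (e.symm k), fun _ α _ => α, fun η i α => ?_⟩
  simp [Formula.realize_equal]

variable {F : Type u} [Field F] {V : Type u} [AddCommGroup V] [Module F V]
  {P : ℕ → Submodule F V}

theorem isStable_chainTheory (hP : IsThickChain P) : IsStable (chainTheory P) := by
  rintro ⟨M, m, n, φ, a, b, h⟩
  obtain ⟨_, _, Q, hQ, e⟩ := exists_eq_chainStructure hP M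
  have hφ := determined_formula hQ φ
  rw [← e] at hφ
  exact hφ.not_orderProperty a b h

theorem not_witnessIct (hP : IsThickChain P) {I : Type u} [Infinite I] {m : ℕ} {n : I → ℕ}
    (φ : ∀ i, (chainLanguage F).Formula (Fin m ⊕ Fin (n i))) :
    ¬ WitnessIct (chainTheory P) φ := by
  classical
  rintro ⟨Λ, _, M, x, y, h⟩
  obtain ⟨_, _, Q, hQ, e⟩ := exists_eq_chainStructure hP M
  have hφ := fun i => determined_formula hQ (φ i)
  rw [← e] at hφ
  -- Already `m + 1` rows are contradictory; on the remaining rows the path is kept constant.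
  let f : Fin (m + 1) ↪ I := Fin.valEmbedding.trans (Infinite.natEmbedding I)
  let l : Λ := Classical.arbitrary Λ
  refine not_independentPattern hQ.antitone (fun i => hφ (f i))
    (fun η => x (Function.extend f η fun _ => l)) (fun i => y (f i)) fun η i α => ?_
  rw [h, f.injective.extend_apply]

theorem IsThickChain.infinite (hP : IsThickChain P) : Infinite V := by
  by_contra h
  rw [not_infinite_iff_finite] at h
  obtain ⟨k, ⟨e⟩⟩ := Finite.exists_equiv_fin V
  obtain ⟨y, -, hy⟩ := hP.avoid 0 k e.symm
  exact hy (e y) (by simp)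

/-- The standard model of `chainTheory P`. -/
def standardModel (P : ℕ → Submodule F V) : Theory.ModelType.{u, 0, u} (chainTheory P) :=
  letI := chainStructure P
  haveI : V ⊨ chainTheory P := inferInstanceAs (V ⊨ (chainLanguage F).completeTheory V)
  Theory.ModelType.of _ V

theorem stronglyDependent1_chainTheory (hP : IsThickChain P) :
    StronglyDependent1 (chainTheory P) := by
  have hmem : ℵ₀ ∈ {κ : Cardinal.{u} | ¬ ∃ (m : ℕ) (n : κ.ord.ToType → ℕ)
      (φ : ∀ i, (chainLanguage F).Formula (Fin m ⊕ Fin (n i))),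
        WitnessIct (chainTheory P) φ} := by
    rintro ⟨m, n, φ, h⟩
    have : Infinite (ℵ₀ : Cardinal.{u}).ord.ToType := by
      rw [Cardinal.infinite_iff, Cardinal.mk_toType, Cardinal.card_ord]
    exact not_witnessIct hP φ h
  refine le_antisymm (csInf_le' hmem) (le_csInf ⟨_, hmem⟩ fun κ hκ => ?_)
  by_contra hlt
  have : Finite κ.ord.ToType := by
    rw [← Cardinal.lt_aleph0_iff_finite, Cardinal.mk_toType, Cardinal.card_ord]
    exact not_le.1 hlt
  have : Infinite (standardModel P) := hP.infinite
  exact hκ (witnessIct_of_finite _ (standardModel P) _)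

theorem isComplete_chainTheory : (chainTheory P).IsComplete := by
  let := chainStructure P
  exact completeTheory.isComplete _ V

end Ranks

/-! ### The concrete chain and the failure of strong² dependence -/

section StandardModel

variable (F : Type u) [Field F]

/-- The space with basis indexed by `ℕ∞ × ℕ`. -/
abbrev ChainSpace : Type u := (ℕ∞ × ℕ) →₀ F

/-- The vectors supported at levels at least `n`. -/
def chainSubspace (n : ℕ) : Submodule F (ChainSpace F) :=
  Finsupp.supported F F {p : ℕ∞ × ℕ | (n : ℕ∞) ≤ p.1}

variable {F}

theorem mem_chainSubspace {n : ℕ} {x : ChainSpace F} :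
    x ∈ chainSubspace F n ↔ ∀ t k, t < (n : ℕ∞) → x (t, k) = 0 := by
  rw [chainSubspace, Finsupp.mem_supported']
  simp

theorem single_mem_chainSubspace {n : ℕ} {t : ℕ∞} (h : (n : ℕ∞) ≤ t) (k : ℕ) (c : F) :
    Finsupp.single (t, k) c ∈ chainSubspace F n :=
  Finsupp.single_mem_supported _ _ h

theorem isThickChain_chainSubspace : IsThickChain (chainSubspace F) where
  zero := eq_top_iff.2 fun x _ => mem_chainSubspace.2 fun t k h => by simp at h
  antitone := fun a b hab => Finsupp.supported_mono fun p (hp : (b : ℕ∞) ≤ p.1) =>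
    le_trans (by exact_mod_cast hab) hp
  avoid := fun n m c => by
    classical
    -- A basis vector of level `n` with a second index unused by every `c i` differs from each of
    -- them at level `n`.
    obtain ⟨k, hk⟩ := (Finset.univ.biUnion fun i => (c i).support.image Prod.snd).exists_notMem
    refine ⟨Finsupp.single ((n : ℕ∞), k) 1, single_mem_chainSubspace le_rfl _ _, fun i hi => ?_⟩
    have h := mem_chainSubspace.1 hi n k (by exact_mod_cast n.lt_succ_self)
    have hc : c i ((n : ℕ∞), k) = 0 := by
      by_contra hne
      exact hk (Finset.mem_biUnion.2 ⟨i, Finset.mem_univ _, Finset.mem_image.2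
        ⟨_, Finsupp.mem_support_iff.2 hne, rfl⟩⟩)
    simp [hc] at h

/-- The coordinates at level `t`. -/
noncomputable def coordinates (F : Type u) [Field F] (t : ℕ∞) :
    ChainSpace F →ₗ[F] ℕ →₀ F :=
  Finsupp.lcomapDomain (fun k => (t, k)) fun _ _ h => (Prod.ext_iff.1 h).2

theorem not_finite_finsupp_nat : ¬ FiniteDimensional F (ℕ →₀ F) := fun _ =>
  not_finite_iff_infinite.2 inferInstance
    (Module.Finite.finite_basis (Finsupp.basisSingleOne (R := F) (ι := ℕ)))

theorem exists_coordinates_eq (t : ℕ∞) (f : ℕ →₀ F) :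
    ∃ x : ChainSpace F, (∀ n : ℕ, (n : ℕ∞) ≤ t → x ∈ chainSubspace F n) ∧
      coordinates F t x = f := by
  refine ⟨f.embDomain ⟨fun k => (t, k), fun _ _ h => (Prod.ext_iff.1 h).2⟩, fun n hn => ?_, ?_⟩
  · refine mem_chainSubspace.2 fun s k hs => Finsupp.embDomain_of_notMem_range _ _ _ ?_
    rintro ⟨k', h⟩
    obtain rfl : t = s := (Prod.ext_iff.1 h).1
    exact absurd hn (not_le.2 hs)
  · ext k
    exact Finsupp.embDomain_apply_self _ f k

/-- The map `g` factors through the quotient and sends it onto an infinite-dimensional space. -/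
theorem not_finiteDimensional_quotient_of_linearMap {V : Type*} [AddCommGroup V] [Module F V]
    {A B : Submodule F V} (g : V →ₗ[F] ℕ →₀ F) (hB : ∀ x ∈ B, g x = 0)
    (hA : ∀ f, ∃ x ∈ A, g x = f) : ¬ FiniteDimensional F (A ⧸ B.submoduleOf A) := by
  intro _
  refine not_finite_finsupp_nat (Module.Finite.of_surjective
    (Submodule.liftQ (B.submoduleOf A) (g.comp A.subtype) fun x hx => hB x hx) fun f => ?_)
  obtain ⟨x, hx, rfl⟩ := hA f
  exact ⟨Submodule.Quotient.mk ⟨x, hx⟩, rfl⟩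

theorem coordinates_eq_zero {n : ℕ} {x : ChainSpace F} (hx : x ∈ chainSubspace F (n + 1)) :
    coordinates F n x = 0 := by
  ext k
  exact mem_chainSubspace.1 hx n k (by exact_mod_cast n.lt_succ_self)

theorem not_finiteDimensional_iInf :
    ¬ FiniteDimensional F (⨅ n, chainSubspace F n : Submodule F (ChainSpace F)) := by
  intro _
  refine not_finite_finsupp_nat (Module.Finite.of_surjective
    ((coordinates F ⊤).comp (⨅ n, chainSubspace F n).subtype) fun f => ?_)
  obtain ⟨x, hx, rfl⟩ := exists_coordinates_eq (F := F) ⊤ f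
  exact ⟨⟨x, (Submodule.mem_iInf _).2 fun n => hx n le_top⟩, rfl⟩

/-- The automorphism of the standard structure induced by a permutation of the basis which
preserves levels. -/
noncomputable def permEquiv (σ : Equiv.Perm (ℕ∞ × ℕ)) (hσ : ∀ p, (σ p).1 = p.1) :
    letI := chainStructure (chainSubspace F)
    ChainSpace F ≃[chainLanguage F] ChainSpace F :=
  letI := chainStructure (chainSubspace F)
  { (Finsupp.domLCongr σ : ChainSpace F ≃ₗ[F] ChainSpace F).toEquiv with
    map_fun' := fun {n} f x => by
      change ChainFunc F n at f
      cases f with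
      | zero => exact map_zero (Finsupp.domLCongr σ : ChainSpace F ≃ₗ[F] ChainSpace F)
      | smul c => exact map_smul (Finsupp.domLCongr σ : ChainSpace F ≃ₗ[F] ChainSpace F) c _
      | add => exact map_add (Finsupp.domLCongr σ : ChainSpace F ≃ₗ[F] ChainSpace F) _ _
      | sub => exact map_sub (Finsupp.domLCongr σ : ChainSpace F ≃ₗ[F] ChainSpace F) _ _
    map_rel' := fun {n} r x => by
      change ChainRel n at r
      cases r with
      | P n =>
        have hσ' : ∀ p, (σ.symm p).1 = p.1 := fun p => by simpa using (hσ (σ.symm p)).symm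
        change Finsupp.domLCongr σ (x 0) ∈ chainSubspace F n ↔ x 0 ∈ chainSubspace F n
        rw [mem_chainSubspace, mem_chainSubspace]
        simp only [Finsupp.domLCongr_apply, Finsupp.domCongr_apply, Finsupp.equivMapDomain_apply]
        constructor
        · intro h t k ht
          simpa using h (σ (t, k)).1 (σ (t, k)).2 (by rwa [hσ])
        · intro h t k ht
          exact h (σ.symm (t, k)).1 (σ.symm (t, k)).2 (by rwa [hσ']) }

/-- The basis vectors of one level are indiscernible over the other ones. -/
theorem indiscernibleOver_single (t : ℕ∞) (A : Set (ChainSpace F))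
    (hA : ∀ x ∈ A, ∃ s k, s ≠ t ∧ x = Finsupp.single (s, k) 1) :
    letI := chainStructure (chainSubspace F)
    IndiscernibleOver (L := chainLanguage F) A
      fun (k : ℕ) (_ : Fin 1) => (Finsupp.single (t, k) 1 : ChainSpace F) := by
  classical
  let := chainStructure (chainSubspace F)
  intro n ψ f g
  -- Moving the finite set of indices by a permutation acting on level `t` alone gives an
  -- automorphism that fixes `A` pointwise.
  obtain ⟨τ, hτ⟩ := Equiv.Perm.exists_extending_pair f g f.injective g.injective
  let σ : Equiv.Perm (ℕ∞ × ℕ) := Equiv.prodShear (Equiv.refl _) fun s => if s = t then τ else 1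
  have hσ1 : ∀ k, σ (t, k) = (t, τ k) := fun k => by simp [σ]
  have hσ2 : ∀ s k, s ≠ t → σ (s, k) = (s, k) := fun s k h => by simp [σ, h]
  let E := permEquiv (F := F) σ fun p => rfl
  have hE : ∀ p, E (Finsupp.single p 1) = Finsupp.single (σ p) 1 := fun p =>
    Finsupp.domLCongr_single (R := F) σ p 1
  rw [← StrongHomClass.realize_formula E ψ]
  refine iff_of_eq (congrArg ψ.Realize (funext ?_))
  rintro (⟨c, hc⟩ | ⟨i, j⟩)
  · obtain ⟨s, k, hs, rfl⟩ := hA c hc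
    simp [hE, hσ2 s k hs]
  · have : τ (f i) = g i := hτ i
    simp [hE, hσ1, this]

/-- The term `x - ∑ z_l - y`. -/
noncomputable def differenceTerm (F : Type u) [Field F] :
    ∀ k : ℕ, (chainLanguage F).Term (Fin 1 ⊕ (Fin 1 ⊕ Fin k)) := fun k =>
  subTerm (((List.finRange k).map fun l => Term.var (.inr (.inr l))).foldl subTerm
    (.var (.inl 0))) (.var (.inr (.inl 0)))

theorem realize_differenceTerm (k : ℕ) (x y : Fin 1 → ChainSpace F)
    (z : Fin k → ChainSpace F) :
    (let := chainStructure (chainSubspace F); (differenceTerm F k).realize (Sum.elim x (Sum.elim y z))) = x 0 - ∑ l, z l - y 0 := by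
  let := chainStructure (chainSubspace F)
  have h : ∀ (s : List (Fin k)) (t : (chainLanguage F).Term (Fin 1 ⊕ (Fin 1 ⊕ Fin k))),
      ((s.map fun l => Term.var (.inr (.inr l))).foldl subTerm t).realize
        (Sum.elim x (Sum.elim y z)) =
        t.realize (Sum.elim x (Sum.elim y z)) - (s.map z).sum := by
    intro s
    induction s with
    | nil => simp
    | cons l s ih =>
      intro t
      simp only [List.map_cons, List.foldl_cons, List.sum_cons, ih, realize_subTerm,
        opSub_chainStructure, Term.realize_var, Sum.elim_inr]
      abel
  simp only [differenceTerm, realize_subTerm, opSub_chainStructure, h, Term.realize_var,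
    Sum.elim_inl, Sum.elim_inr]
  rw [← List.ofFn_eq_map, List.sum_ofFn]

/-- Row `i` consists of the basis vectors of level `e i`, and `b i` lists the first vector of each
lower level. If `x` is the sum of the first vectors, subtracting `b i` leaves the first vector of
level `e i` modulo `P (e i + 1)`, so the formula holds at index `0` and fails at index `1`. -/
theorem exists_witnessIct2 {I : Type u} [LinearOrder I] (e : I ≃o ℕ) :
    ∃ (m : ℕ) (n k : I → ℕ)
      (φ : ∀ i, (chainLanguage F).Formula (Fin m ⊕ (Fin (n i) ⊕ Fin (k i)))),
      WitnessIct2 (chainTheory (chainSubspace F)) φ := by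
  classical
  let := chainStructure (chainSubspace F)
  refine ⟨1, fun _ => 1, fun i => e i, fun i => Relations.formula₁ (L := chainLanguage F)
    (ChainRel.P (e i + 1)) (differenceTerm F (e i)), standardModel (chainSubspace F),
    fun i k _ => (Finsupp.single ((e i : ℕ∞), k) 1 : ChainSpace F),
    fun i l => (Finsupp.single (((l : ℕ) : ℕ∞), 0) 1 : ChainSpace F),
    fun i => ?_, fun i l => ?_, fun s => ?_⟩
  · refine indiscernibleOver_single _ _ ?_
    rintro x ⟨j, hj, k, -, rfl⟩
    exact ⟨_, k, by simpa using hj, rfl⟩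
  · refine ⟨e.symm l, ?_, 0, 0, ?_⟩
    · rw [← e.lt_iff_lt, e.apply_symm_apply]
      exact l.2
    · simp only [OrderIso.apply_symm_apply]; rfl
  -- Vectors have finite support, so the sum is cut off above the levels in `s`; finite
  -- satisfiability asks for no more.
  · obtain ⟨N, hN⟩ : ∃ N, ∀ i ∈ s, e i < N :=
      ⟨s.sup e + 1, fun i hi => Nat.lt_succ_of_le (Finset.le_sup hi)⟩
    let b : ℕ → ChainSpace F := fun l => Finsupp.single ((l : ℕ∞), 0) 1
    refine ⟨fun _ => (∑ l ∈ Finset.range N, b l : ChainSpace F), fun i hi => ?_⟩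
    have key : ∀ y : ChainSpace F,
        (∑ l ∈ Finset.range N, b l) - ∑ l : Fin (e i), b l - y ∈ chainSubspace F (e i + 1) ↔
          b (e i) - y ∈ chainSubspace F (e i + 1) := by
      intro y
      have hsum : (∑ l ∈ Finset.range N, b l) - ∑ l : Fin (e i), b l - y =
          ∑ l ∈ Finset.Ico (e i + 1) N, b l + (b (e i) - y) := by
        rw [Fin.sum_univ_eq_sum_range, ← Finset.sum_Ico_eq_sub _ (hN i hi).le,
          Finset.sum_eq_sum_Ico_succ_bot (hN i hi)]
        abel
      rw [hsum]
      refine Submodule.add_mem_iff_right _ (Submodule.sum_mem _ fun l hl => ?_)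
      exact single_mem_chainSubspace (by exact_mod_cast (Finset.mem_Ico.1 hl).1) _ _
    have hreal : ∀ k : ℕ, _ ↔ _ := fun k => key (Finsupp.single ((e i : ℕ∞), k) 1)
    constructor
    · refine Formula.realize_rel₁.2 ?_
      change Term.realize _ _ ∈ chainSubspace F _
      erw [realize_differenceTerm]
      exact (hreal 0).2 (by simp [b])
    · intro h
      have h := Formula.realize_rel₁.1 h
      change Term.realize _ _ ∈ chainSubspace F _ at h
      erw [realize_differenceTerm] at h
      have := mem_chainSubspace.1 ((hreal 1).1 h) (e i) 0 (by exact_mod_cast Nat.lt_succ_self _)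
      simp [b] at this

theorem not_stronglyDependent2 : ¬ StronglyDependent2 (chainTheory (chainSubspace F)) := by
  intro h
  have hne : {κ : Cardinal.{u} | ¬ ∃ (m : ℕ) (n k : κ.ord.ToType → ℕ)
      (φ : ∀ i, (chainLanguage F).Formula (Fin m ⊕ (Fin (n i) ⊕ Fin (k i)))),
        WitnessIct2 (chainTheory (chainSubspace F)) φ}.Nonempty := by
    -- The infimum of the empty set is `0`, so the value `ℵ₀` rules out this default and is
    -- attained.
    by_contra hempty
    rw [Set.not_nonempty_iff_eq_empty] at hempty
    rw [StronglyDependent2, kappaIct2, hempty, Cardinal.sInf_empty] at h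
    exact Cardinal.aleph0_ne_zero h.symm
  have hmem := csInf_mem hne
  change kappaIct2 _ ∈ _ at hmem
  rw [show kappaIct2 _ = ℵ₀ from h] at hmem
  -- An order isomorphism with `ℕ` is needed, not just a bijection, since `b i` may only use earlier
  -- rows.
  obtain ⟨r⟩ := Ordinal.lift_type_eq.{u, 0, 0}.1 (show Ordinal.lift.{0}
      (Ordinal.type (α := (ℵ₀ : Cardinal.{u}).ord.ToType) (· < ·)) =
        Ordinal.lift.{u} (Ordinal.type (α := ℕ) (· < ·)) by
    rw [Ordinal.type_toType, Cardinal.ord_aleph0, Ordinal.lift_uzero]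
    rfl)
  exact hmem (exists_witnessIct2 (OrderIso.ofRelIsoLT r))

end StandardModel
end ShelahStrong

open ShelahStrong in
theorem mainTheorem7 (F : Type u) [Field F] :
    ∃ T : (chainLanguage F).Theory,
      T.IsComplete ∧
      (∃ (V : Type u) (_ : AddCommGroup V) (_ : Module F V) (P : ℕ → Submodule F V),
        P 0 = ⊤ ∧ Antitone P ∧
        (∀ n, ¬ FiniteDimensional F (P n ⧸ (P (n + 1)).submoduleOf (P n))) ∧
        ¬ FiniteDimensional F (⨅ n, P n : Submodule F V) ∧
        T = chainTheory P) ∧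
      StronglyStable1 T ∧ ¬ StronglyStable2 T := by
  have h := isThickChain_chainSubspace (F := F)
  exact ⟨chainTheory (chainSubspace F), isComplete_chainTheory,
    ⟨ChainSpace F, inferInstance, inferInstance, chainSubspace F, h.zero, h.antitone,
      fun n => not_finiteDimensional_quotient_of_linearMap (coordinates F n)
        (fun _ hx => coordinates_eq_zero hx)
        fun f => (exists_coordinates_eq n f).imp fun _ hx => ⟨hx.1 n le_rfl, hx.2⟩,
      not_finiteDimensional_iInf, rfl⟩,
    ⟨stronglyDependent1_chainTheory h, isStable_chainTheory h⟩,
    fun h2 => not_stronglyDependent2 h2.1⟩
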